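/- Let $G$ be a word hyperbolic group, i.e. a group having a finite generating set $S$ and a constant $\delta\ge 0$ such that, in the Cayley graph of $G$ with respect to $S$, each side of every geodesic triangle with vertices in $G$ lies in the $\delta$-neighbourhood of the union of the other two sides. Let $H$ be an infinite quasi-convex subgroup of $G$, i.e. an infinite subgroup for which there are a finite generating set $S'$ of $G$ and a constant $K\ge 0$ such that every geodesic with endpoints in $H$ in the Cayley graph of $G$ with respect to $S'$ lies in the $K$-neighbourhood of $H$. Then $H$ has finite index in its commensurator $$\mathrm{Comm}(H,G)=\{g\in G : gHg^{-1}\cap H \text{ has finite index in both } gHg^{-1} \text{ and } H\},$$ which is a subgroup of $G$ containing $H$. -/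

import Mathlib

/-- A walk in a graph is geodesic if it is a shortest edge path between its endpoints. -/
def SimpleGraph.Walk.IsGeodesicPath {V : Type*} {Γ : SimpleGraph V} {u v : V}
    (p : Γ.Walk u v) : Prop :=
  p.length = Γ.dist u v

/-- Geodesic triangles of `Γ` (with vertices at vertices of `Γ`) are `δ`-thin: each side lies in
the `δ`-neighbourhood of the union of the other two. The bound is stated for one side of the
triangle; by symmetry in `x`, `y`, `z` it holds for each of them. -/
def SimpleGraph.HasThinTriangles {V : Type*} (Γ : SimpleGraph V) (δ : ℕ) : Prop :=
  ∀ (x y z : V) (p : Γ.Walk x y) (q : Γ.Walk y z) (r : Γ.Walk x z),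
    p.IsGeodesicPath → q.IsGeodesicPath → r.IsGeodesicPath →
      ∀ a ∈ p.support, ∃ b, (b ∈ q.support ∨ b ∈ r.support) ∧ Γ.dist a b ≤ δ

/-- `G` is word hyperbolic: geodesic triangles in the Cayley graph of `G` with respect to some
finite generating set are uniformly thin. -/
def IsWordHyperbolic (G : Type*) [Group G] : Prop :=
  ∃ S : Set G, S.Finite ∧ Subgroup.closure S = ⊤ ∧
    ∃ δ : ℕ, (SimpleGraph.mulCayley S).HasThinTriangles δ

/-- `H` is quasi-convex in `G`: for some finite generating set of `G`, there is a constant `K` such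
that each geodesic of the Cayley graph joining two elements of `H` lies in the `K`-neighbourhood
of `H`. The generating set need not be the one that witnesses hyperbolicity of `G`. -/
def Subgroup.IsQuasiconvex {G : Type*} [Group G] (H : Subgroup G) : Prop :=
  ∃ S : Set G, S.Finite ∧ Subgroup.closure S = ⊤ ∧
    ∃ K : ℕ, ∀ x ∈ H, ∀ y ∈ H, ∀ p : (SimpleGraph.mulCayley S).Walk x y, p.IsGeodesicPath →
      ∀ a ∈ p.support, ∃ h ∈ H, (SimpleGraph.mulCayley S).dist a h ≤ K

/-!
Compute all distances in a Cayley graph with thin triangles. Since geodesics stay uniformly close to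
quasi-geodesics (the Morse lemma), `H` is quasi-convex for this Cayley graph too.

If `gHg⁻¹ ∩ H` has finite index in `H`, then the orbit of `gH` under the left action of `H` on
`G ⧸ H` is finite, which means that `H` lies in a bounded neighbourhood of `gH`. As `H` is infinite,
it contains two points so far apart that the middle of a geodesic joining them is `2δ`-close to a
geodesic joining points of `gH`, no matter how large the neighbourhood was. By quasi-convexity, `H`
and `gH` come within a distance `R` of each other which does not depend on `g`. So each finite
`H`-orbit meets the finite set of cosets represented by the ball of radius `R`, and there are only
finitely many cosets with finite orbit.
-/

open SimpleGraph Filter MulAction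
open scoped Pointwise

namespace WordHyperbolic

section Graph

variable {V : Type*} {Γ : SimpleGraph V}

/-- The vertex `a` lies on some geodesic from `x` to `y`. Geodesics are handled through this
relation, which avoids walks and their dependent endpoints. -/
def IsBetween (Γ : SimpleGraph V) (x a y : V) : Prop :=
  Γ.dist x a + Γ.dist a y = Γ.dist x y

lemma isBetween_left (x y : V) : IsBetween Γ x x y := by
  rw [IsBetween, dist_self, zero_add]

lemma IsBetween.symm {x a y : V} (h : IsBetween Γ x a y) : IsBetween Γ y a x := by
  rw [IsBetween, Γ.dist_comm (u := y), Γ.dist_comm (v := x), Γ.dist_comm (v := x), add_comm, h]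

lemma isBetween_of_mem_support (hΓ : Γ.Connected) {x a y : V} {p : Γ.Walk x y}
    (hp : p.IsGeodesicPath) (ha : a ∈ p.support) : IsBetween Γ x a y := by
  classical
  refine le_antisymm ?_ hΓ.dist_triangle
  rw [← hp, ← p.take_spec ha, Walk.length_append]
  exact add_le_add (dist_le _) (dist_le _)

lemma IsBetween.exists_isGeodesicPath (hΓ : Γ.Connected) {x a y : V} (h : IsBetween Γ x a y) :
    ∃ p : Γ.Walk x y, p.IsGeodesicPath ∧ a ∈ p.support := by
  obtain ⟨p, hp⟩ := hΓ.exists_walk_length_eq_dist x a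
  obtain ⟨q, hq⟩ := hΓ.exists_walk_length_eq_dist a y
  refine ⟨p.append q, ?_, by simp⟩
  rw [Walk.IsGeodesicPath, Walk.length_append, hp, hq, h]

lemma dist_getVert_of_isGeodesicPath {x y : V} {p : Γ.Walk x y} (hp : p.IsGeodesicPath) {i : ℕ}
    (hi : i ≤ p.length) : Γ.dist x (p.getVert i) = i := by
  rw [← length_eq_dist_of_subwalk hp (p.isSubwalk_take i), Walk.take_length, min_eq_left hi]

lemma exists_isBetween_dist_eq (hΓ : Γ.Connected) (x y : V) {k : ℕ} (hk : k ≤ Γ.dist x y) :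
    ∃ a, IsBetween Γ x a y ∧ Γ.dist x a = k := by
  obtain ⟨p, hp⟩ := hΓ.exists_walk_length_eq_dist x y
  exact ⟨p.getVert k, isBetween_of_mem_support hΓ hp (p.getVert_mem_support k),
    dist_getVert_of_isGeodesicPath hp (hk.trans hp.ge)⟩

lemma IsBetween.trans_left (hΓ : Γ.Connected) {x u a y : V} (ha : IsBetween Γ x a y)
    (hu : IsBetween Γ x u a) : IsBetween Γ x u y := by
  have h₁ := hΓ.dist_triangle (u := u) (v := a) (w := y)
  have h₂ := hΓ.dist_triangle (u := x) (v := u) (w := y)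
  unfold IsBetween at *
  omega

lemma IsBetween.of_trans_left (hΓ : Γ.Connected) {x u a y : V} (ha : IsBetween Γ x a y)
    (hu : IsBetween Γ x u a) : IsBetween Γ u a y := by
  have h₁ := hΓ.dist_triangle (u := u) (v := a) (w := y)
  have h₂ := hΓ.dist_triangle (u := x) (v := u) (w := y)
  unfold IsBetween at *
  omega

lemma dist_map_le_mul_dist {W : Type*} {Λ : SimpleGraph W} (hΛ : Λ.Connected)
    (hΓ : Γ.Connected) {f : V → W} {L : ℕ} (hL : ∀ x y, Γ.Adj x y → Λ.dist (f x) (f y) ≤ L)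
    (x y : V) : Λ.dist (f x) (f y) ≤ L * Γ.dist x y := by
  obtain ⟨p, hp⟩ := hΓ.exists_walk_length_eq_dist x y
  rw [← hp]
  clear hp
  induction p with
  | nil => simp
  | @cons u v w huv p ih =>
    calc Λ.dist (f u) (f w)
      _ ≤ Λ.dist (f u) (f v) + Λ.dist (f v) (f w) := hΛ.dist_triangle
      _ ≤ L + L * p.length := add_le_add (hL u v huv) ih
      _ = L * (p.cons huv).length := by rw [Walk.length_cons]; ring

lemma finite_setOf_dist_le (hΓ : Γ.Connected) (hfin : ∀ v, (Γ.neighborSet v).Finite) (x : V)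
    (n : ℕ) : {y | Γ.dist x y ≤ n}.Finite := by
  induction n with
  | zero =>
    exact (Set.finite_singleton x).subset fun y hy =>
      (hΓ.dist_eq_zero_iff.1 (Nat.le_zero.1 hy)).symm
  | succ n ih =>
    refine (ih.union (ih.biUnion fun a _ => hfin a)).subset fun y hy => ?_
    rcases Nat.lt_or_ge n (Γ.dist x y) with hny | hyn
    · obtain ⟨a, ha, hxa⟩ := exists_isBetween_dist_eq hΓ x y hny.le
      have hay : Γ.dist a y = 1 := by
        have hy : Γ.dist x y ≤ n + 1 := hy
        unfold IsBetween at ha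
        omega
      exact Or.inr (Set.mem_biUnion hxa.le (dist_eq_one_iff_adj.1 hay))
    · exact Or.inl hyn

section ThinPolygons

variable {δ : ℕ}

lemma exists_dist_le_of_triangle (hδ : Γ.HasThinTriangles δ) (hΓ : Γ.Connected) {x y a : V}
    (z : V) (ha : IsBetween Γ x a y) :
    ∃ b, (IsBetween Γ y b z ∨ IsBetween Γ x b z) ∧ Γ.dist a b ≤ δ := by
  obtain ⟨p, hp, hap⟩ := ha.exists_isGeodesicPath hΓ
  obtain ⟨q, hq⟩ := hΓ.exists_walk_length_eq_dist y z
  obtain ⟨r, hr⟩ := hΓ.exists_walk_length_eq_dist x z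
  obtain ⟨b, hb, hab⟩ := hδ x y z p q r hp hq hr a hap
  exact ⟨b, hb.imp (isBetween_of_mem_support hΓ hq) (isBetween_of_mem_support hΓ hr), hab⟩

lemma exists_dist_le_of_quadrilateral (hδ : Γ.HasThinTriangles δ) (hΓ : Γ.Connected) {x y a : V}
    (z w : V) (ha : IsBetween Γ x a y) :
    ∃ b, (IsBetween Γ y b z ∨ IsBetween Γ z b w ∨ IsBetween Γ x b w) ∧ Γ.dist a b ≤ 2 * δ := by
  obtain ⟨b, hyb | hxb, hab⟩ := exists_dist_le_of_triangle hδ hΓ z ha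
  · exact ⟨b, Or.inl hyb, by omega⟩
  · obtain ⟨b', hb', hbb'⟩ := exists_dist_le_of_triangle hδ hΓ w hxb
    have := hΓ.dist_triangle (u := a) (v := b) (w := b')
    exact ⟨b', Or.inr hb', by omega⟩

-- Bisect the path: each halving replaces the geodesic by one of the other two sides of a triangle.
lemma exists_dist_le_of_path (hδ : Γ.HasThinTriangles δ) (hΓ : Γ.Connected) {L n : ℕ} {c : ℕ → V}
    (hc : ∀ i < n, Γ.dist (c i) (c (i + 1)) ≤ L) (k : ℕ) {i j : ℕ} (hij : i ≤ j) (hjn : j ≤ n)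
    (hjk : j ≤ i + 2 ^ k) {a : V} (ha : IsBetween Γ (c i) a (c j)) :
    ∃ m ≤ n, Γ.dist a (c m) ≤ δ * k + L := by
  induction k generalizing i j a with
  | zero =>
    have hcij : Γ.dist (c i) (c j) ≤ L := by
      obtain rfl | rfl : j = i ∨ j = i + 1 := by omega
      · simp
      · exact hc i hjn
    refine ⟨i, hij.trans hjn, ?_⟩
    rw [Γ.dist_comm]
    unfold IsBetween at ha
    omega
  | succ k ih =>
    rw [pow_succ] at hjk
    obtain ⟨b, hb, hab⟩ := exists_dist_le_of_triangle hδ hΓ (c ((i + j) / 2)) ha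
    obtain ⟨m, hm, hbm⟩ : ∃ m ≤ n, Γ.dist b (c m) ≤ δ * k + L := by
      rcases hb with hb | hb
      · exact ih (by omega) hjn (by omega) hb.symm
      · exact ih (by omega) (by omega) (by omega) hb
    have := hΓ.dist_triangle (u := a) (v := b) (w := c m)
    exact ⟨m, hm, by rw [mul_add]; omega⟩

end ThinPolygons

section Morse

/-- The points `c 0, …, c n` form a discrete quasi-geodesic: consecutive points are at distance at
most `L`, and the number of steps between two points is at most `M` times their distance. The
second condition is written without subtraction, and is void for `j ≤ i`. -/
structure IsQuasigeodesic (Γ : SimpleGraph V) (L M n : ℕ) (c : ℕ → V) : Prop where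
  dist_succ_le : ∀ i < n, Γ.dist (c i) (c (i + 1)) ≤ L
  le_add_mul_dist : ∀ i ≤ n, ∀ j ≤ n, j ≤ i + M * Γ.dist (c i) (c j)

variable {δ L M n : ℕ} {c : ℕ → V}

lemma IsQuasigeodesic.exists_dist_le_clog (hc : IsQuasigeodesic Γ L M n c)
    (hδ : Γ.HasThinTriangles δ) (hΓ : Γ.Connected) {i j d : ℕ} (hi : i ≤ n) (hj : j ≤ n)
    (hd : Γ.dist (c i) (c j) ≤ d) {a : V} (ha : IsBetween Γ (c i) a (c j)) :
    ∃ m ≤ n, Γ.dist a (c m) ≤ δ * Nat.clog 2 (M * d) + L := by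
  wlog hij : i ≤ j generalizing i j
  · exact this hj hi (Γ.dist_comm ▸ hd) ha.symm (le_of_not_ge hij)
  refine exists_dist_le_of_path hδ hΓ hc.dist_succ_le _ hij hj ?_ ha
  calc j
    _ ≤ i + M * Γ.dist (c i) (c j) := hc.le_add_mul_dist i hi j hj
    _ ≤ i + M * d := by gcongr
    _ ≤ i + 2 ^ Nat.clog 2 (M * d) := by gcongr; exact Nat.le_pow_clog one_lt_two _

lemma exists_isBetween_farthest {x y : V} {A : Set V} (hy : y ∈ A) :
    ∃ p D, IsBetween Γ x p y ∧ (∀ a ∈ A, D ≤ Γ.dist p a) ∧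
      ∀ u, IsBetween Γ x u y → ∃ a ∈ A, Γ.dist u a ≤ D := by
  set F : Set ℕ := {D | ∃ p, IsBetween Γ x p y ∧ ∀ a ∈ A, D ≤ Γ.dist p a}
  have hF₀ : F.Nonempty := ⟨0, x, isBetween_left x y, fun _ _ => Nat.zero_le _⟩
  have hF : BddAbove F := by
    refine ⟨Γ.dist x y, ?_⟩
    rintro D ⟨p, hp, hD⟩
    exact (hD y hy).trans (hp ▸ Nat.le_add_left _ _)
  obtain ⟨p, hp, hD⟩ := Nat.sSup_mem hF₀ hF
  refine ⟨p, sSup F, hp, hD, fun u hu => ?_⟩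
  by_contra! hfar
  exact (le_csSup hF ⟨u, hu, hfar⟩).not_gt (Nat.lt_succ_self _)

lemma exists_isBetween_detour (hΓ : Γ.Connected) {e p : V} {A : Set V} {D : ℕ} (he : e ∈ A)
    (hfar : ∀ a ∈ A, D ≤ Γ.dist p a) (hnear : ∀ u, IsBetween Γ e u p → ∃ a ∈ A, Γ.dist u a ≤ D) :
    ∃ u, IsBetween Γ e u p ∧ Γ.dist u p ≤ 2 * D ∧
      ∃ a ∈ A, Γ.dist u a ≤ D ∧ ∀ w, IsBetween Γ u w a → D ≤ Γ.dist p w := by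
  rcases le_or_gt (Γ.dist e p) (2 * D) with hle | hgt
  · refine ⟨e, isBetween_left e p, hle, e, he, by simp, fun w hw => ?_⟩
    have hew : Γ.dist e w = 0 := by
      rw [IsBetween, dist_self] at hw
      omega
    rw [← hΓ.dist_eq_zero_iff.1 hew]
    exact hfar e he
  · obtain ⟨u, hu, heu⟩ := exists_isBetween_dist_eq hΓ e p (k := Γ.dist e p - 2 * D) (by omega)
    obtain ⟨a, ha, hua⟩ := hnear u hu
    have hup : Γ.dist u p = 2 * D := by
      unfold IsBetween at hu
      omega
    refine ⟨u, hu, hup.le, a, ha, hua, fun w hw => ?_⟩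
    have htri := hΓ.dist_triangle (u := u) (v := w) (w := p)
    rw [Γ.dist_comm (u := w)] at htri
    unfold IsBetween at hw
    omega

-- In the quadrilateral `u, v, c j, c i` around `p`, the sides `[v, c j]` and `[c i, u]` stay at
-- distance `D` from `p`. So, unless `D ≤ 2 * δ`, the point `p` is close to `[c i, c j]`, which is
-- logarithmically close to the path because its length is at most `D + 2 * D + 2 * D + D`.
lemma IsQuasigeodesic.farthest_le_clog (hc : IsQuasigeodesic Γ L M n c)
    (hδ : Γ.HasThinTriangles δ) (hΓ : Γ.Connected) {p : V} {D : ℕ}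
    (hp : IsBetween Γ (c 0) p (c n)) (hfar : ∀ a ∈ c '' Set.Iic n, D ≤ Γ.dist p a)
    (hnear : ∀ u, IsBetween Γ (c 0) u (c n) → ∃ a ∈ c '' Set.Iic n, Γ.dist u a ≤ D) :
    D ≤ 2 * δ + L + δ * Nat.clog 2 (M * (6 * D)) := by
  have hc₀ : c 0 ∈ c '' Set.Iic n := ⟨0, n.zero_le, rfl⟩
  have hcₙ : c n ∈ c '' Set.Iic n := ⟨n, le_refl n, rfl⟩
  obtain ⟨u, hu, hup, _, ⟨i, hi, rfl⟩, hui, hu_far⟩ :=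
    exists_isBetween_detour hΓ hc₀ hfar fun u hu => hnear u (hp.trans_left hΓ hu)
  obtain ⟨v, hv, hvp, _, ⟨j, hj, rfl⟩, hvj, hv_far⟩ :=
    exists_isBetween_detour hΓ hcₙ hfar fun v hv => hnear v (hp.symm.trans_left hΓ hv).symm
  have hupv : IsBetween Γ u p v := ((hp.of_trans_left hΓ hu).symm.of_trans_left hΓ hv).symm
  have hij : Γ.dist (c i) (c j) ≤ 6 * D := by
    have h₁ := hΓ.dist_triangle (u := c i) (v := u) (w := c j)
    have h₂ := hΓ.dist_triangle (u := u) (v := p) (w := c j)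
    have h₃ := hΓ.dist_triangle (u := p) (v := v) (w := c j)
    rw [Γ.dist_comm (u := c i) (v := u)] at h₁
    rw [Γ.dist_comm (u := p) (v := v)] at h₃
    omega
  obtain ⟨b, hb, hpb⟩ := exists_dist_le_of_quadrilateral hδ hΓ (c j) (c i) hupv
  rcases hb with hvb | hjbi | hub
  · have := hv_far b hvb
    omega
  · obtain ⟨m, hm, hbm⟩ := hc.exists_dist_le_clog hδ hΓ hi hj hij hjbi.symm
    have hDm := hfar _ ⟨m, hm, rfl⟩
    have htri := hΓ.dist_triangle (u := p) (v := b) (w := c m)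
    omega
  · have := hu_far b hub
    omega

lemma eventually_mul_le_two_pow (A : ℕ) : ∀ᶠ q : ℕ in atTop, A * q ≤ 2 ^ q := by
  have ho := (isLittleO_coe_const_pow_of_one_lt (R := ℝ) one_lt_two).const_mul_left (A : ℝ)
  filter_upwards [ho.eventuallyLE] with q hq
  have hq : (A : ℝ) * q ≤ 2 ^ q := by simpa using hq
  exact_mod_cast hq

lemma exists_forall_le_of_le_add_mul_clog (A B C : ℕ) :
    ∃ R, ∀ D, D ≤ B + C * Nat.clog 2 (A * D) → D ≤ R := by
  obtain ⟨q₀, hq₀⟩ := eventually_atTop.1 (eventually_mul_le_two_pow (A * (B + 2 * C)))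
  refine ⟨B + C * (q₀ + 1), fun D hD => hD.trans ?_⟩
  gcongr
  by_contra! hk
  obtain ⟨q, hq⟩ : ∃ q, Nat.clog 2 (A * D) = q + 1 := ⟨_, (Nat.succ_pred (by omega)).symm⟩
  have hlt : 2 ^ q < A * D := Nat.pow_lt_of_lt_clog (by omega)
  refine hlt.not_ge ?_
  calc A * D
    _ ≤ A * (B + C * (q + 1)) := by gcongr; exact hq ▸ hD
    _ ≤ A * ((B + 2 * C) * q) := by gcongr; nlinarith [show 1 ≤ q by omega]
    _ = A * (B + 2 * C) * q := by ring
    _ ≤ 2 ^ q := hq₀ q (by omega)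

theorem exists_forall_isQuasigeodesic_dist_le (hδ : Γ.HasThinTriangles δ) (hΓ : Γ.Connected)
    (L M : ℕ) : ∃ R, ∀ n c, IsQuasigeodesic Γ L M n c →
      ∀ a, IsBetween Γ (c 0) a (c n) → ∃ i ≤ n, Γ.dist a (c i) ≤ R := by
  obtain ⟨R, hR⟩ := exists_forall_le_of_le_add_mul_clog (M * 6) (2 * δ + L) δ
  refine ⟨R, fun n c hc a ha => ?_⟩
  have hcₙ : c n ∈ c '' Set.Iic n := ⟨n, le_refl n, rfl⟩
  obtain ⟨p, D, hp, hfar, hnear⟩ := exists_isBetween_farthest (Γ := Γ) (x := c 0) hcₙ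
  obtain ⟨_, ⟨i, hi, rfl⟩, hai⟩ := hnear a ha
  have hD := hc.farthest_le_clog hδ hΓ hp hfar hnear
  exact ⟨i, hi, hai.trans (hR D (mul_assoc M 6 D ▸ hD))⟩

end Morse

section Quasiconvex

/-- Every geodesic of `Γ` with endpoints in `A` lies in the `K`-neighbourhood of `A`. -/
def IsQuasiconvexSet (Γ : SimpleGraph V) (K : ℕ) (A : Set V) : Prop :=
  ∀ x ∈ A, ∀ y ∈ A, ∀ a, IsBetween Γ x a y → ∃ b ∈ A, Γ.dist a b ≤ K

lemma isQuasigeodesic_getVert {Γ' : SimpleGraph V} (hΓ' : Γ'.Connected) {L M : ℕ}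
    (hL : ∀ x y, Γ.dist x y ≤ L * Γ'.dist x y) (hM : ∀ x y, Γ'.dist x y ≤ M * Γ.dist x y)
    {x y : V} {p : Γ'.Walk x y} (hp : p.IsGeodesicPath) :
    IsQuasigeodesic Γ L M p.length p.getVert where
  dist_succ_le i hi := by
    simpa [dist_eq_one_iff_adj.2 (p.adj_getVert_succ hi)] using
      hL (p.getVert i) (p.getVert (i + 1))
  le_add_mul_dist i hi j hj :=
    calc j
      _ = Γ'.dist x (p.getVert j) := (dist_getVert_of_isGeodesicPath hp hj).symm
      _ ≤ Γ'.dist x (p.getVert i) + Γ'.dist (p.getVert i) (p.getVert j) := hΓ'.dist_triangle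
      _ ≤ i + M * Γ.dist (p.getVert i) (p.getVert j) :=
        add_le_add (dist_getVert_of_isGeodesicPath hp hi).le (hM _ _)

theorem IsQuasiconvexSet.exists_of_bilipschitz {Γ' : SimpleGraph V} {K δ L M : ℕ} {A : Set V}
    (hA : IsQuasiconvexSet Γ' K A) (hΓ' : Γ'.Connected) (hδ : Γ.HasThinTriangles δ)
    (hΓ : Γ.Connected) (hL : ∀ x y, Γ.dist x y ≤ L * Γ'.dist x y)
    (hM : ∀ x y, Γ'.dist x y ≤ M * Γ.dist x y) : ∃ K', IsQuasiconvexSet Γ K' A := by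
  obtain ⟨R, hR⟩ := exists_forall_isQuasigeodesic_dist_le hδ hΓ L M
  refine ⟨R + L * K, fun x hx y hy a ha => ?_⟩
  obtain ⟨p, hp⟩ := hΓ'.exists_walk_length_eq_dist x y
  obtain ⟨i, -, hai⟩ := hR _ _ (isQuasigeodesic_getVert hΓ' hL hM hp) a (by simpa using ha)
  obtain ⟨b, hb, hib⟩ := hA x hx y hy _ (isBetween_of_mem_support hΓ' hp (p.getVert_mem_support i))
  refine ⟨b, hb, ?_⟩
  calc Γ.dist a b
    _ ≤ Γ.dist a (p.getVert i) + Γ.dist (p.getVert i) b := hΓ.dist_triangle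
    _ ≤ R + L * K := add_le_add hai ((hL _ _).trans (Nat.mul_le_mul_left L hib))

-- The bound on the distance does not involve `D`: a point at distance greater than `D + 2 * δ` from
-- both ends of `[x, y]` can only be close to the side `[x', y']` of the quadrilateral.
theorem exists_dist_le_of_isQuasiconvexSet {δ K K' : ℕ} (hδ : Γ.HasThinTriangles δ)
    (hΓ : Γ.Connected) {A B : Set V} (hA : IsQuasiconvexSet Γ K A) (hB : IsQuasiconvexSet Γ K' B)
    {D : ℕ} {x y x' y' : V} (hx : x ∈ A) (hy : y ∈ A) (hx' : x' ∈ B) (hy' : y' ∈ B)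
    (hxx' : Γ.dist x x' ≤ D) (hyy' : Γ.dist y y' ≤ D) (hxy : 2 * (D + 2 * δ + 1) ≤ Γ.dist x y) :
    ∃ a ∈ A, ∃ b ∈ B, Γ.dist a b ≤ K + 2 * δ + K' := by
  obtain ⟨m, hm, hxm⟩ := exists_isBetween_dist_eq hΓ x y (k := D + 2 * δ + 1) (by omega)
  obtain ⟨m', hm', hmm'⟩ := exists_dist_le_of_quadrilateral hδ hΓ y' x' hm
  have hm'B : IsBetween Γ y' m' x' := by
    have h₁ := hΓ.dist_triangle (u := x) (v := m') (w := m)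
    have h₂ := hΓ.dist_triangle (u := m) (v := m') (w := y)
    rw [Γ.dist_comm (u := m')] at h₁ h₂
    unfold IsBetween at hm hm' ⊢
    omega
  obtain ⟨a, ha, hma⟩ := hA x hx y hy m hm
  obtain ⟨b, hb, hm'b⟩ := hB y' hy' x' hx' m' hm'B
  refine ⟨a, ha, b, hb, ?_⟩
  calc Γ.dist a b
    _ ≤ Γ.dist a m + Γ.dist m b := hΓ.dist_triangle
    _ ≤ Γ.dist a m + (Γ.dist m m' + Γ.dist m' b) := by gcongr; exact hΓ.dist_triangle
    _ ≤ K + 2 * δ + K' := by rw [Γ.dist_comm (u := a)]; omega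

end Quasiconvex

end Graph

section CayleyGraph

variable {G : Type*} [Group G] {S : Set G}

lemma dist_mul_left (hS : (mulCayley S).Connected) (g x y : G) :
    (mulCayley S).dist (g * x) (g * y) = (mulCayley S).dist x y := by
  have hle (g x y : G) : (mulCayley S).dist (g * x) (g * y) ≤ (mulCayley S).dist x y := by
    simpa using dist_map_le_mul_dist hS hS (f := (g * ·)) (L := 1)
      (fun _ _ h => (dist_eq_one_iff_adj.2 (mulCayley_adj_mul_iff_right.2 h)).le) x y
  exact (hle g x y).antisymm (by simpa using hle g⁻¹ (g * x) (g * y))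

lemma reachable_mul_left {x y : G} (g : G) (h : (mulCayley S).Reachable x y) :
    (mulCayley S).Reachable (g * x) (g * y) :=
  h.map ⟨(g * ·), mulCayley_adj_mul_iff_right.2⟩

lemma connected_mulCayley (hS : Subgroup.closure S = ⊤) : (mulCayley S).Connected := by
  have h_one (g : G) : (mulCayley S).Reachable 1 g := by
    induction (hS ▸ Subgroup.mem_top g : g ∈ Subgroup.closure S)
      using Subgroup.closure_induction with
    | mem s hs =>
      by_cases h : 1 = s
      · rw [h]
      · exact Adj.reachable ((mulCayley_adj S 1 s).2 ⟨h, Or.inl (by simpa using hs)⟩)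
    | one => exact Reachable.refl _
    | mul x y _ _ hx hy => exact hx.trans (by simpa using reachable_mul_left x hy)
    | inv x _ hx => simpa using (reachable_mul_left x⁻¹ hx).symm
  exact (connected_iff _).2 ⟨fun x y => (h_one x).symm.trans (h_one y), ⟨1⟩⟩

lemma finite_neighborSet_mulCayley (hS : S.Finite) (g : G) :
    ((mulCayley S).neighborSet g).Finite := by
  refine ((hS.union hS.inv).image (g * ·)).subset fun x hx => ⟨g⁻¹ * x, ?_, by simp⟩
  exact ((mulCayley_adj S g x).1 hx).2.imp id fun h => by simpa using h

lemma exists_dist_mulCayley_le_mul {S' : Set G} (hS : (mulCayley S).Connected)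
    (hS'_fin : S'.Finite) (hS' : (mulCayley S').Connected) :
    ∃ L, ∀ x y, (mulCayley S).dist x y ≤ L * (mulCayley S').dist x y := by
  obtain ⟨L, hL⟩ := (hS'_fin.image fun s => (mulCayley S).dist 1 s).bddAbove
  have hL' (x y : G) (h : x⁻¹ * y ∈ S') : (mulCayley S).dist x y ≤ L := by
    rw [← dist_mul_left hS x⁻¹, inv_mul_cancel]
    exact hL ⟨_, h, rfl⟩
  refine ⟨L, dist_map_le_mul_dist (f := id) hS hS' fun x y hxy => ?_⟩
  rcases ((mulCayley_adj S' x y).1 hxy).2 with h | h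
  · exact hL' x y h
  · exact dist_comm.trans_le (hL' y x h)

lemma isBetween_mul_left (hS : (mulCayley S).Connected) (g : G) {x a y : G} :
    IsBetween (mulCayley S) (g * x) (g * a) (g * y) ↔ IsBetween (mulCayley S) x a y := by
  simp only [IsBetween, dist_mul_left hS]

lemma IsQuasiconvexSet.smul (hS : (mulCayley S).Connected) {K : ℕ} {A : Set G}
    (hA : IsQuasiconvexSet (mulCayley S) K A) (g : G) :
    IsQuasiconvexSet (mulCayley S) K (g • A) := by
  rintro _ ⟨x, hx, rfl⟩ _ ⟨y, hy, rfl⟩ a ha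
  obtain ⟨b, hb, hab⟩ := hA x hx y hy (g⁻¹ * a)
    ((isBetween_mul_left hS g).1 (by simpa using ha))
  refine ⟨g * b, Set.smul_mem_smul_set hb, ?_⟩
  simpa using (dist_mul_left hS g (g⁻¹ * a) b).trans_le hab

theorem exists_isQuasiconvexSet {H : Subgroup G} (hH : H.IsQuasiconvex) (hS_fin : S.Finite)
    (hS : (mulCayley S).Connected) {δ : ℕ} (hδ : (mulCayley S).HasThinTriangles δ) :
    ∃ K, IsQuasiconvexSet (mulCayley S) K (H : Set G) := by
  obtain ⟨S', hS'_fin, hS'_gen, K, hK⟩ := hH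
  have hS' := connected_mulCayley hS'_gen
  obtain ⟨L, hL⟩ := exists_dist_mulCayley_le_mul hS hS'_fin hS'
  obtain ⟨M, hM⟩ := exists_dist_mulCayley_le_mul hS' hS_fin hS
  have hHS' : IsQuasiconvexSet (mulCayley S') K (H : Set G) := by
    intro x hx y hy a ha
    obtain ⟨p, hp, hap⟩ := ha.exists_isGeodesicPath hS'
    exact hK x hx y hy p hp a hap
  exact hHS'.exists_of_bilipschitz hS' hδ hS hL hM

end CayleyGraph

section Cosets

variable {G : Type*} [Group G] {A B : Subgroup G}

lemma ncard_orbit_mk (g : G) :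
    (orbit A (g : G ⧸ B)).ncard = (ConjAct.toConjAct g • B).relIndex A := by
  have hstab : stabilizer A (g : G ⧸ B) = (ConjAct.toConjAct g • B).subgroupOf A := by
    ext a
    calc a ∈ stabilizer A (g : G ⧸ B)
      _ ↔ (g : G ⧸ B) = (a * g : G) := eq_comm
      _ ↔ g⁻¹ * (a * g) ∈ B := QuotientGroup.eq
      _ ↔ a ∈ (ConjAct.toConjAct g • B).subgroupOf A := by
        rw [Subgroup.mem_subgroupOf, Subgroup.mem_pointwise_smul_iff_inv_smul_mem,
          ← ConjAct.toConjAct_inv, ConjAct.toConjAct_smul, inv_inv, mul_assoc]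
  rw [← index_stabilizer, hstab, Subgroup.relIndex]

lemma finite_orbit_mk_iff {g : G} :
    (orbit A (g : G ⧸ B)).Finite ↔ (ConjAct.toConjAct g • B).relIndex A ≠ 0 := by
  rw [← ncard_orbit_mk]
  exact ⟨fun h => Set.ncard_ne_zero_of_mem (mem_orbit_self _) h, Set.finite_of_ncard_ne_zero⟩

lemma exists_dist_le_of_finite_orbit {S : Set G} (hS : (mulCayley S).Connected) {g : G}
    (hg : (orbit A (g : G ⧸ B)).Finite) :
    ∃ D, ∀ a ∈ A, ∃ x ∈ g • (B : Set G), (mulCayley S).dist a x ≤ D := by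
  obtain ⟨D, hD⟩ := (hg.image fun q => (mulCayley S).dist 1 q.out).bddAbove
  refine ⟨D, fun a ha => ?_⟩
  let q : G ⧸ B := (a⁻¹ * g : G)
  have hq : q ∈ orbit A (g : G ⧸ B) := ⟨⟨a⁻¹, A.inv_mem ha⟩, rfl⟩
  obtain ⟨b, hb⟩ := QuotientGroup.mk_out_eq_mul B (a⁻¹ * g)
  refine ⟨g * b, Set.smul_mem_smul_set b.2, ?_⟩
  calc (mulCayley S).dist a (g * b)
    _ = (mulCayley S).dist 1 q.out := by
      rw [← dist_mul_left hS a⁻¹, inv_mul_cancel, ← mul_assoc, ← hb]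
    _ ≤ D := hD ⟨q, hq, rfl⟩

theorem exists_mem_orbit_dist_le [Infinite A] {S : Set G} (hS_fin : S.Finite)
    (hS : (mulCayley S).Connected) {δ K K' : ℕ} (hδ : (mulCayley S).HasThinTriangles δ)
    (hA : IsQuasiconvexSet (mulCayley S) K (A : Set G))
    (hB : IsQuasiconvexSet (mulCayley S) K' (B : Set G)) {q : G ⧸ B} (hq : (orbit A q).Finite) :
    ∃ u : G, (mulCayley S).dist 1 u ≤ K + 2 * δ + K' ∧ (u : G ⧸ B) ∈ orbit A q := by
  obtain ⟨g, rfl⟩ := QuotientGroup.mk_surjective q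
  obtain ⟨D, hD⟩ := exists_dist_le_of_finite_orbit hS hq
  obtain ⟨y, hy, hy_far⟩ : ∃ y ∈ A, 2 * (D + 2 * δ + 1) < (mulCayley S).dist 1 y := by
    by_contra! hbdd
    exact Set.infinite_coe_iff.1 ‹Infinite A›
      ((finite_setOf_dist_le hS (finite_neighborSet_mulCayley hS_fin) 1 _).subset hbdd)
  obtain ⟨x', hx', hxx'⟩ := hD 1 A.one_mem
  obtain ⟨y', hy', hyy'⟩ := hD y hy
  obtain ⟨a, ha, _, ⟨b, hb, rfl⟩, hab⟩ := exists_dist_le_of_isQuasiconvexSet hδ hS hA (hB.smul hS g)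
    A.one_mem hy hx' hy' hxx' hyy' hy_far.le
  refine ⟨a⁻¹ * (g * b), ?_, ⟨a⁻¹, A.inv_mem ha⟩, ?_⟩
  · rwa [← dist_mul_left hS a, mul_one, mul_inv_cancel_left]
  · exact QuotientGroup.eq.2 (by simpa [mul_assoc] using hb)

theorem finite_setOf_finite_orbit [Infinite A] (hG : IsWordHyperbolic G) (hA : A.IsQuasiconvex)
    (hB : B.IsQuasiconvex) : {q : G ⧸ B | (orbit A q).Finite}.Finite := by
  obtain ⟨S, hS_fin, hS_gen, δ, hδ⟩ := hG
  have hS := connected_mulCayley hS_gen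
  obtain ⟨K, hK⟩ := exists_isQuasiconvexSet hA hS_fin hS hδ
  obtain ⟨K', hK'⟩ := exists_isQuasiconvexSet hB hS_fin hS hδ
  have hball := finite_setOf_dist_le hS (finite_neighborSet_mulCayley hS_fin) 1 (K + 2 * δ + K')
  let F : Set (G ⧸ B) := {q ∈ (↑) '' {u : G | (mulCayley S).dist 1 u ≤ K + 2 * δ + K'} |
    (orbit A q).Finite}
  have hF : F.Finite := (hball.image _).subset (Set.sep_subset _ _)
  refine (hF.biUnion fun q hq => hq.2).subset fun q hq => ?_
  obtain ⟨u, hu, huq⟩ := exists_mem_orbit_dist_le hS_fin hS hδ hK hK' hq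
  refine Set.mem_biUnion (x := (u : G ⧸ B)) ⟨⟨u, hu, rfl⟩, ?_⟩ (mem_orbit_symm.1 huq)
  rwa [orbit_eq_iff.2 huq]

lemma le_commensurator (H : Subgroup G) : H ≤ Subgroup.Commensurable.commensurator H := by
  intro h hh
  have hconj : ConjAct.toConjAct h • H = H := Subgroup.conj_smul_eq_self_of_mem hh
  rw [Subgroup.Commensurable.commensurator_mem_iff, hconj]

lemma finiteIndex_subgroupOf_of_finite_orbit {H C : Subgroup G}
    (h : (orbit C ((1 : G) : G ⧸ H)).Finite) : (H.subgroupOf C).FiniteIndex :=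
  ⟨show H.relIndex C ≠ 0 by simpa using finite_orbit_mk_iff.1 h⟩

end Cosets

end WordHyperbolic

open WordHyperbolic

theorem theorem16 {G : Type*} [Group G] (hG : IsWordHyperbolic G)
    (H : Subgroup G) (hinf : Infinite H) (hH : H.IsQuasiconvex) :
    H ≤ Subgroup.Commensurable.commensurator H ∧
      (H.subgroupOf (Subgroup.Commensurable.commensurator H)).FiniteIndex := by
  refine ⟨le_commensurator H, finiteIndex_subgroupOf_of_finite_orbit ?_⟩
  refine (finite_setOf_finite_orbit hG hH hH).subset ?_
  rintro _ ⟨⟨g, hg⟩, rfl⟩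
  have hgH : (orbit H (g : G ⧸ H)).Finite :=
    finite_orbit_mk_iff.2 ((Subgroup.Commensurable.commensurator_mem_iff H g).1 hg).1
  change (orbit H ((g * 1 : G) : G ⧸ H)).Finite
  rwa [mul_one]
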